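/- Let $b>0$ be a real number. Let $\Lambda=\{(mb,n): m,n\in\mathbb Z\}\subset\mathbb R^2$ be the lattice generated by the $1\times b$ rectangle, and call two points of the plane equivalent if one can be mapped to the other by a finite composition of point reflections in nodes of $\Lambda$. A covering (on both sides, in a single layer) of the $1\times b$ rectangle by equal squares is a finite set $G$ of closed squares in the plane, in arbitrary position, all with the same side length $a>0$ and with pairwise disjoint interiors, such that (i) every point of the plane is equivalent to some point of the union of the squares of $G$; (ii) no two distinct points of the interior of the union of the squares of $G$ are equivalent. (This models covering both sides of an envelope by equal squares, which may be folded over its edges.) **Theorem.** The $1\times b$ rectangle has a covering by equal squares if and only if there are rational numbers $p\ge r\ge 0$ such that $b=p+\sqrt{p^2-r^2}$ or $b=p-\sqrt{p^2-r^2}$. -/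

import Mathlib

namespace EnvelopeCovering

/-- The Euclidean plane with a fixed Cartesian coordinate system. -/
abbrev Plane : Type := EuclideanSpace ℝ (Fin 2)

/-- The lattice `{(m b, n) : m, n ∈ ℤ}` generated by the `1 × b` rectangle. -/
def lattice (b : ℝ) : Set Plane :=
  {x | ∃ m n : ℤ, x = !₂[(m : ℝ) * b, (n : ℝ)]}

/-- All finite compositions of point reflections in nodes of the lattice. -/
def reflectionCompositions (b : ℝ) : Submonoid (Equiv.Perm Plane) :=
  Submonoid.closure (Equiv.pointReflection '' lattice b)

/-- Two points are equivalent if some composition of point reflections in nodes of the lattice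
takes one to the other. -/
def Equivalent (b : ℝ) (x y : Plane) : Prop :=
  ∃ g ∈ reflectionCompositions b, g x = y

/-- `S` is a closed (filled) square of side length `a`, in arbitrary position: it has a corner `c`
and two perpendicular sides of length `a`, in the directions of the unit vectors `u` and `v`. -/
def IsSquareOfSide (a : ℝ) (S : Set Plane) : Prop :=
  ∃ c u v : Plane, ‖u‖ = 1 ∧ ‖v‖ = 1 ∧ inner ℝ u v = 0 ∧
    S = {x | ∃ s ∈ Set.Icc (0 : ℝ) a, ∃ t ∈ Set.Icc (0 : ℝ) a, x = c + s • u + t • v}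

/-- `G` is a covering (on both sides, in a single layer) of the `1 × b` rectangle by equal
squares. -/
structure IsCovering (b : ℝ) (G : Set (Set Plane)) : Prop where
  finite : G.Finite
  equal_squares : ∃ a : ℝ, 0 < a ∧ ∀ S ∈ G, IsSquareOfSide a S
  disjoint_interiors : ∀ S ∈ G, ∀ T ∈ G, S ≠ T → Disjoint (interior S) (interior T)
  covers : ∀ x : Plane, ∃ y ∈ ⋃₀ G, Equivalent b x y
  single_layer : ∀ x ∈ interior (⋃₀ G), ∀ y ∈ interior (⋃₀ G), Equivalent b x y → x = y

end EnvelopeCovering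

namespace EnvelopeCovering

/-! The group generated by the reflections consists of the maps `x ↦ ±x + t` with `t ∈ 2Λ`, and the
images of a covering under it tile the plane by equal squares. Two tiles sharing a point that is a
vertex of neither are parallel (`sameFrame_of_mem`), and the plane minus the countable set of
vertices is connected, so all tiles are parallel. The planar Keller theorem (`columns_or_rows`) then
arranges them in columns or in rows. Translations by `(2b, 0)` and `(0, 2)` preserve the tiling.
Measured in sides, their components across the columns are integers `m`, `n`, not both zero, and the
combination that stays in a column moves along it by an integer. Eliminating direction and side
gives `b²n² + m² = kb`, hence `b² + r² = 2pb` with `p`, `r` rational, whose roots are `p ± √(p² -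
r²)`.

Conversely, let `b² + r² = 2pb` with `r = m/n` in lowest terms. Along the direction of `(m/b, n)`,
the lattice `2Λ` lies on perpendicular lines at spacing `2A`, with period `B` on each line. Point
reflection halves the strip between two lines, so an `A × B` rectangle is a fundamental domain. Its
ratio `B/A = 4n²p` is rational, so equal squares fill it. -/

open Filter Topology

/-! ### Planar Keller theorem for half-open unit squares -/

/-- If the half-open unit intervals starting at the points of `D` partition the line, then any two
points of `D` differ by an integer. -/
theorem exists_int_of_interval_partition {D : Set ℝ}
    (hex : ∀ x, ∃ d ∈ D, d ≤ x ∧ x < d + 1)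
    (huniq : ∀ x, ∀ d ∈ D, ∀ e ∈ D, d ≤ x → x < d + 1 → e ≤ x → x < e + 1 → d = e)
    {d e : ℝ} (hd : d ∈ D) (he : e ∈ D) : ∃ k : ℤ, e - d = k := by
  -- The interval containing `d + 1` starts at some `f` with `d < f ≤ d + 1`; if `f < d + 1`, then
  -- `f` would lie in two intervals.
  have hsucc : ∀ d ∈ D, d + 1 ∈ D := by
    intro d hd
    obtain ⟨f, hf, h1, h2⟩ := hex (d + 1)
    rcases h1.lt_or_eq with h | h
    · have := huniq f d hd f hf (by linarith) h le_rfl (by linarith)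
      linarith
    · rwa [← h]
  have hadd : ∀ d ∈ D, ∀ n : ℕ, d + n ∈ D := by
    intro d hd n
    induction n with
    | zero => simpa using hd
    | succ n ih => simpa [add_assoc] using hsucc _ ih
  have main : ∀ d ∈ D, ∀ e ∈ D, d ≤ e → ∃ k : ℤ, e - d = k := by
    intro d hd e he hde
    have h0 : (0 : ℝ) ≤ e - d := by linarith
    have h1 := Nat.floor_le h0
    have h2 := Nat.lt_floor_add_one (e - d)
    have := huniq e _ (hadd d hd ⌊e - d⌋₊) e he (by linarith) (by linarith) le_rfl (by linarith)
    exact ⟨⌊e - d⌋₊, by push_cast; linarith⟩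
  rcases le_total d e with h | h
  · exact main d hd e he h
  · obtain ⟨k, hk⟩ := main e he d hd h
    exact ⟨-k, by push_cast; linarith⟩

/-- The half-open unit squares with lower left corners in `C` partition the plane. -/
structure IsUnitSquarePartition (C : Set (ℝ × ℝ)) : Prop where
  exists_mem : ∀ x y : ℝ, ∃ c ∈ C, (c.1 ≤ x ∧ x < c.1 + 1) ∧ (c.2 ≤ y ∧ y < c.2 + 1)
  unique : ∀ x y : ℝ, ∀ c ∈ C, ∀ d ∈ C, (c.1 ≤ x ∧ x < c.1 + 1) → (c.2 ≤ y ∧ y < c.2 + 1) →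
    (d.1 ≤ x ∧ x < d.1 + 1) → (d.2 ≤ y ∧ y < d.2 + 1) → c = d

namespace IsUnitSquarePartition

variable {C : Set (ℝ × ℝ)}

theorem swap (h : IsUnitSquarePartition C) : IsUnitSquarePartition (Prod.swap ⁻¹' C) where
  exists_mem x y := by
    obtain ⟨c, hc, h1, h2⟩ := h.exists_mem y x
    exact ⟨c.swap, by simpa using hc, h2, h1⟩
  unique x y c hc d hd h1 h2 h3 h4 :=
    Prod.swap_injective (h.unique y x c.swap hc d.swap hd h2 h1 h4 h3)

/-- Squares meeting a common vertical line have vertical coordinates congruent modulo one. -/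
theorem exists_int_snd_sub (h : IsUnitSquarePartition C) {c d : ℝ × ℝ} (hc : c ∈ C) (hd : d ∈ C)
    {x : ℝ} (hcx : c.1 ≤ x ∧ x < c.1 + 1) (hdx : d.1 ≤ x ∧ x < d.1 + 1) :
    ∃ k : ℤ, d.2 - c.2 = k := by
  refine exists_int_of_interval_partition
    (D := {y | ∃ c ∈ C, (c.1 ≤ x ∧ x < c.1 + 1) ∧ c.2 = y}) ?_ ?_ ⟨c, hc, hcx, rfl⟩ ⟨d, hd, hdx, rfl⟩
  · intro y
    obtain ⟨e, he, h1, h2⟩ := h.exists_mem x y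
    exact ⟨e.2, ⟨e, he, h1, rfl⟩, h2⟩
  · rintro y _ ⟨e, he, h1, rfl⟩ _ ⟨f, hf, h2, rfl⟩ h3 h4 h5 h6
    rw [h.unique x y e he f hf h1 ⟨h3, h4⟩ h2 ⟨h5, h6⟩]

/-- Every horizontal line through a square of the partition is cut at the integer translates of
the corner of that square. -/
theorem exists_mem_fst_eq (h : IsUnitSquarePartition C) {c : ℝ × ℝ} (hc : c ∈ C) (k : ℤ) :
    ∃ d ∈ C, d.1 = c.1 + k := by
  obtain ⟨d, hd, h1, h2⟩ := h.exists_mem (c.1 + k) c.2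
  obtain ⟨l, hl⟩ := h.swap.exists_int_snd_sub (c := c.swap) (d := d.swap) (x := c.2)
    (by simpa using hc) (by simpa using hd) ⟨le_rfl, by simp⟩ h2
  simp only [Prod.snd_swap] at hl
  have hlk : l = k := by
    have a1 : l < k + 1 := by
      have : (l : ℝ) < k + 1 := by linarith
      exact_mod_cast this
    have a2 : k < l + 1 := by
      have : (k : ℝ) < l + 1 := by linarith
      exact_mod_cast this
    omega
  exact ⟨d, hd, by rw [← hlk]; linarith⟩

/-- Keller's theorem in the plane, for a pair of squares. -/
theorem exists_int_sub (h : IsUnitSquarePartition C) {c d : ℝ × ℝ} (hc : c ∈ C) (hd : d ∈ C) :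
    (∃ k : ℤ, d.1 - c.1 = k) ∨ ∃ k : ℤ, d.2 - c.2 = k := by
  by_contra! hcon
  obtain ⟨hn1, hn2⟩ := hcon
  -- `W x` says that the vertical line at `x` is cut at heights congruent to `c.2`. Any one square
  -- meeting the line decides this, so `W` is constant on each unit cell of the horizontal grid
  -- through any corner.
  let W : ℝ → Prop := fun x => ∃ e ∈ C, (e.1 ≤ x ∧ x < e.1 + 1) ∧ ∃ k : ℤ, e.2 - c.2 = k
  have hW : ∀ e ∈ C, ∀ x, e.1 ≤ x → x < e.1 + 1 → (W x ↔ ∃ k : ℤ, e.2 - c.2 = k) := by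
    intro e he x h1 h2
    refine ⟨?_, fun hk => ⟨e, he, ⟨h1, h2⟩, hk⟩⟩
    rintro ⟨f, hf, h3, k, hk⟩
    obtain ⟨l, hl⟩ := h.exists_int_snd_sub hf he h3 ⟨h1, h2⟩
    exact ⟨k + l, by push_cast; linarith⟩
  have hcell : ∀ e ∈ C, ∀ k : ℤ, ∀ x, e.1 + k ≤ x → x < e.1 + k + 1 → (W x ↔ W (e.1 + k)) := by
    intro e he k x h1 h2
    obtain ⟨f, hf, h3⟩ := h.exists_mem_fst_eq he k
    rw [← h3] at h1 h2 ⊢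
    rw [hW f hf x h1 h2, hW f hf f.1 le_rfl (by linarith)]
  -- The grids of `c` and `d` are offset by a non-integer, so a cell of the `d`-grid straddles each
  -- cut of the `c`-grid and carries `W` across it.
  have hstep : ∀ k : ℤ, (W (c.1 + k) ↔ W (c.1 + (k + 1 : ℤ))) := by
    intro k
    set j := ⌊c.1 + (k + 1 : ℤ) - d.1⌋ with hj
    have h1 := Int.floor_le (c.1 + (k + 1 : ℤ) - d.1)
    have h2 := Int.lt_floor_add_one (c.1 + (k + 1 : ℤ) - d.1)
    rw [← hj] at h1 h2
    have h3 : (j : ℝ) ≠ c.1 + (k + 1 : ℤ) - d.1 := by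
      intro h3
      refine hn1 (k + 1 - j) ?_
      push_cast at h3 ⊢
      linarith
    have h4 := lt_of_le_of_ne h1 h3
    push_cast at h1 h2 h4
    rw [hcell d hd j (c.1 + (k + 1 : ℤ)) (by push_cast; linarith) (by push_cast; linarith),
      ← hcell c hc k (d.1 + j) (by linarith) (by linarith)]
  have hall : ∀ k : ℤ, W (c.1 + k) := by
    intro k
    induction k using Int.induction_on with
    | zero => exact (hW c hc _ (by simp) (by simp)).2 ⟨0, by simp⟩
    | succ k ih => exact (hstep _).1 ih
    | pred k ih =>
      refine (hstep _).2 ?_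
      simpa using ih
  have h1 := Int.floor_le (d.1 - c.1)
  have h2 := Int.lt_floor_add_one (d.1 - c.1)
  have hWd := (hcell c hc ⌊d.1 - c.1⌋ d.1 (by linarith) (by linarith)).2 (hall _)
  obtain ⟨k, hk⟩ := (hW d hd d.1 le_rfl (by linarith)).1 hWd
  exact hn2 k hk

/-- A partition of the plane into unit squares consists of columns or of rows. -/
theorem columns_or_rows (h : IsUnitSquarePartition C) :
    (∀ c ∈ C, ∀ d ∈ C, ∃ k : ℤ, d.1 - c.1 = k) ∨ ∀ c ∈ C, ∀ d ∈ C, ∃ k : ℤ, d.2 - c.2 = k := by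
  by_contra! hcon
  obtain ⟨⟨c, hc, d, hd, h1⟩, ⟨e, he, f, hf, h2⟩⟩ := hcon
  obtain ⟨k, hk⟩ := (h.exists_int_sub hc hd).resolve_left (by simpa using h1)
  -- No `g` is horizontally congruent to both `c` and `d`, so it is vertically congruent to one of
  -- them, and these two agree vertically.
  have key : ∀ g ∈ C, ∃ l : ℤ, g.2 - c.2 = l := by
    intro g hg
    rcases h.exists_int_sub hc hg with ⟨l, hl⟩ | hl
    · rcases h.exists_int_sub hd hg with ⟨l', hl'⟩ | ⟨l', hl'⟩
      · exact absurd (show d.1 - c.1 = (l - l' : ℤ) by push_cast; linarith) (h1 _)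
      · exact ⟨l' + k, by push_cast; linarith⟩
    · exact hl
  obtain ⟨k₁, hk₁⟩ := key e he
  obtain ⟨k₂, hk₂⟩ := key f hf
  exact h2 (k₂ - k₁) (by push_cast; linarith)

/-- If a partition into columns of unit squares is invariant under two translations, then their
horizontal components are integers `m` and `n`, and the combination killing these components has
integral vertical component. -/
theorem exists_int_of_columns (h : IsUnitSquarePartition C)
    (hcol : ∀ c ∈ C, ∀ d ∈ C, ∃ k : ℤ, d.1 - c.1 = k) {τ σ : ℝ × ℝ}
    (hτ : ∀ c ∈ C, ∀ k : ℤ, c + k • τ ∈ C) (hσ : ∀ c ∈ C, ∀ k : ℤ, c + k • σ ∈ C) :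
    ∃ m n k : ℤ, τ.1 = m ∧ σ.1 = n ∧ n * τ.2 - m * σ.2 = k := by
  obtain ⟨c, hc, -, -⟩ := h.exists_mem 0 0
  obtain ⟨m, hm⟩ := hcol c hc _ (hτ c hc 1)
  obtain ⟨n, hn⟩ := hcol c hc _ (hσ c hc 1)
  simp only [one_smul, Prod.fst_add, add_sub_cancel_left] at hm hn
  -- The translation `n τ - m σ` has horizontal part `nm - mn = 0`, so it moves `c` within its own
  -- column.
  have hd := hσ _ (hτ c hc n) (-m)
  have hfst : (c + n • τ + (-m) • σ).1 = c.1 := by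
    simp [hm, hn]; ring
  obtain ⟨k, hk⟩ := h.exists_int_snd_sub hc hd (x := c.1) ⟨le_rfl, by simp⟩
    (by rw [hfst]; exact ⟨le_rfl, by simp⟩)
  refine ⟨m, n, k, hm, hn, ?_⟩
  rw [← hk]
  simp
  ring

end IsUnitSquarePartition

/-! ### Frames and squares in coordinates -/

/-- The first coordinate of `x` in the frame with first axis `u`. -/
def coordX (u x : ℝ × ℝ) : ℝ := u.1 * x.1 + u.2 * x.2

/-- The second coordinate of `x` in the frame with first axis `u`. -/
def coordY (u x : ℝ × ℝ) : ℝ := u.1 * x.2 - u.2 * x.1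

/-- The rotation by a right angle. -/
def quarterTurn (u : ℝ × ℝ) : ℝ × ℝ := (-u.2, u.1)

/-- The closed square with centre `z`, inradius `h` and a side parallel to `u`. -/
def closedSq (h : ℝ) (z u : ℝ × ℝ) : Set (ℝ × ℝ) :=
  {x | |coordX u (x - z)| ≤ h ∧ |coordY u (x - z)| ≤ h}

/-- The open square with centre `z`, inradius `h` and a side parallel to `u`. -/
def openSq (h : ℝ) (z u : ℝ × ℝ) : Set (ℝ × ℝ) :=
  {x | |coordX u (x - z)| < h ∧ |coordY u (x - z)| < h}

/-- The vertices of `closedSq h z u`. -/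
def vertices (h : ℝ) (z u : ℝ × ℝ) : Set (ℝ × ℝ) :=
  {x | |coordX u (x - z)| = h ∧ |coordY u (x - z)| = h}

/-- `u` and `v` agree up to quarter turns. -/
def SameFrame (u v : ℝ × ℝ) : Prop :=
  v = u ∨ v = -u ∨ v = quarterTurn u ∨ v = -quarterTurn u

theorem coordX_sub (u x y : ℝ × ℝ) : coordX u (x - y) = coordX u x - coordX u y := by
  simp [coordX]; ring

theorem coordY_sub (u x y : ℝ × ℝ) : coordY u (x - y) = coordY u x - coordY u y := by
  simp [coordY]; ring

theorem coordX_add (u x y : ℝ × ℝ) : coordX u (x + y) = coordX u x + coordX u y := by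
  simp [coordX]; ring

theorem coordX_smul (u x : ℝ × ℝ) (t : ℝ) : coordX u (t • x) = t * coordX u x := by
  simp [coordX]; ring

theorem coordY_smul (u x : ℝ × ℝ) (t : ℝ) : coordY u (t • x) = t * coordY u x := by
  simp [coordY]; ring

theorem coordX_neg_left (u x : ℝ × ℝ) : coordX (-u) x = -coordX u x := by
  simp [coordX]; ring

theorem coordY_neg_left (u x : ℝ × ℝ) : coordY (-u) x = -coordY u x := by
  simp [coordY]; ring

theorem coordX_quarterTurn (u x : ℝ × ℝ) : coordX (quarterTurn u) x = coordY u x := by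
  simp [coordX, coordY, quarterTurn]; ring

theorem coordY_quarterTurn (u x : ℝ × ℝ) : coordY (quarterTurn u) x = -coordX u x := by
  simp [coordX, coordY, quarterTurn]; ring

@[fun_prop]
theorem continuous_coordX (u : ℝ × ℝ) : Continuous (coordX u) := by
  unfold coordX; fun_prop

@[fun_prop]
theorem continuous_coordY (u : ℝ × ℝ) : Continuous (coordY u) := by
  unfold coordY; fun_prop

theorem sq_add_sq_coord {u : ℝ × ℝ} (hu : u.1 ^ 2 + u.2 ^ 2 = 1) (x : ℝ × ℝ) :
    x.1 = u.1 * coordX u x - u.2 * coordY u x ∧ x.2 = u.2 * coordX u x + u.1 * coordY u x := by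
  simp only [coordX, coordY]
  constructor
  · linear_combination -x.1 * hu
  · linear_combination -x.2 * hu

theorem quarterTurn_neg (u : ℝ × ℝ) : quarterTurn (-u) = -quarterTurn u := by
  simp [quarterTurn]

theorem quarterTurn_quarterTurn (u : ℝ × ℝ) : quarterTurn (quarterTurn u) = -u := by
  simp [quarterTurn, Prod.ext_iff]

namespace SameFrame

variable {u v w : ℝ × ℝ}

theorem refl (u : ℝ × ℝ) : SameFrame u u := Or.inl rfl

theorem symm (h : SameFrame u v) : SameFrame v u := by
  rcases h with rfl | rfl | rfl | rfl <;>
    simp [SameFrame, quarterTurn_neg, quarterTurn_quarterTurn]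

theorem trans (h : SameFrame u v) (h' : SameFrame v w) : SameFrame u w := by
  rcases h with rfl | rfl | rfl | rfl <;> rcases h' with rfl | rfl | rfl | rfl <;>
    simp [SameFrame, quarterTurn_neg, quarterTurn_quarterTurn]

theorem neg_right (h : SameFrame u v) : SameFrame u (-v) := h.trans (Or.inr (Or.inl rfl))

theorem closedSq_eq (hf : SameFrame u v) (h : ℝ) (z : ℝ × ℝ) : closedSq h z v = closedSq h z u := by
  rcases hf with rfl | rfl | rfl | rfl <;>
    simp [closedSq, coordX_neg_left, coordY_neg_left, coordX_quarterTurn, coordY_quarterTurn,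
      and_comm]

theorem openSq_eq (hf : SameFrame u v) (h : ℝ) (z : ℝ × ℝ) : openSq h z v = openSq h z u := by
  rcases hf with rfl | rfl | rfl | rfl <;>
    simp [openSq, coordX_neg_left, coordY_neg_left, coordX_quarterTurn, coordY_quarterTurn,
      and_comm]

end SameFrame

theorem isClosed_closedSq (h : ℝ) (z u : ℝ × ℝ) : IsClosed (closedSq h z u) := by
  rw [closedSq, Set.ofPred_and]
  exact (isClosed_le (by fun_prop) (by fun_prop)).inter (isClosed_le (by fun_prop) (by fun_prop))

theorem isOpen_openSq (h : ℝ) (z u : ℝ × ℝ) : IsOpen (openSq h z u) := by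
  rw [openSq, Set.ofPred_and]
  exact (isOpen_lt (by fun_prop) (by fun_prop)).inter (isOpen_lt (by fun_prop) (by fun_prop))

theorem openSq_subset_closedSq (h : ℝ) (z u : ℝ × ℝ) : openSq h z u ⊆ closedSq h z u :=
  fun _ hx => ⟨hx.1.le, hx.2.le⟩

theorem mem_openSq_self {h : ℝ} (hh : 0 < h) (z u : ℝ × ℝ) : z ∈ openSq h z u := by
  simp [openSq, coordX, coordY, hh]

theorem abs_sub_le_of_mem_closedSq {h : ℝ} {z u x : ℝ × ℝ} (hu : u.1 ^ 2 + u.2 ^ 2 = 1)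
    (hx : x ∈ closedSq h z u) : |x.1 - z.1| ≤ 2 * h ∧ |x.2 - z.2| ≤ 2 * h := by
  obtain ⟨h1, h2⟩ := sq_add_sq_coord hu (x - z)
  obtain ⟨h3, h4⟩ := hx
  have hu1 : |u.1| ≤ 1 := abs_le_one_iff_mul_self_le_one.2 (by nlinarith [sq_nonneg u.2])
  have hu2 : |u.2| ≤ 1 := abs_le_one_iff_mul_self_le_one.2 (by nlinarith [sq_nonneg u.1])
  have key : ∀ {s t : ℝ}, |s| ≤ 1 → |t| ≤ h → |s * t| ≤ h := by
    intro s t hs ht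
    rw [abs_mul]
    nlinarith [abs_nonneg s, abs_nonneg t]
  constructor
  · rw [← Prod.fst_sub, h1]
    linarith [abs_sub (u.1 * coordX u (x - z)) (u.2 * coordY u (x - z)), key hu1 h3, key hu2 h4]
  · rw [← Prod.snd_sub, h2]
    linarith [abs_add_le (u.2 * coordX u (x - z)) (u.1 * coordY u (x - z)), key hu2 h3,
      key hu1 h4]

theorem countable_vertices (h : ℝ) {z u : ℝ × ℝ} (hu : u.1 ^ 2 + u.2 ^ 2 = 1) :
    (vertices h z u).Countable := by
  have hfin : (({h, -h} : Set ℝ) ×ˢ ({h, -h} : Set ℝ)).Finite :=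
    (Set.toFinite _).prod (Set.toFinite _)
  have hinj : Function.Injective fun x : ℝ × ℝ => (coordX u (x - z), coordY u (x - z)) := by
    intro x y hxy
    obtain ⟨h1, h2⟩ := Prod.ext_iff.1 hxy
    simp only at h1 h2
    have hx := sq_add_sq_coord hu (x - z)
    have hy := sq_add_sq_coord hu (y - z)
    rw [h1, h2, ← hy.1, ← hy.2] at hx
    exact sub_left_injective (Prod.ext hx.1 hx.2)
  refine ((hfin.preimage hinj.injOn).subset ?_).countable
  rintro x ⟨h1, h2⟩
  simp only [Set.mem_preimage, Set.mem_prod, Set.mem_insert_iff, Set.mem_singleton_iff]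
  exact ⟨eq_or_eq_neg_of_abs_eq h1, eq_or_eq_neg_of_abs_eq h2⟩

/-- At a point of a square which is not a vertex, the square contains germs of all directions in
some open half plane bounded by a side direction. -/
theorem exists_halfPlane {h : ℝ} {z u p : ℝ × ℝ} (hp : p ∈ closedSq h z u)
    (hv : p ∉ vertices h z u) : ∃ w, SameFrame u w ∧
      ∀ d, 0 < coordX w d → ∀ᶠ ε in 𝓝[>] (0 : ℝ), p + ε • d ∈ openSq h z u := by
  -- The model case: `p` is interior or on the side `coordX = -h`. The other sides reduce to it by
  -- replacing `u` by `-u` or a quarter turn.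
  have aux : ∀ u : ℝ × ℝ, -h ≤ coordX u (p - z) → coordX u (p - z) < h →
      |coordY u (p - z)| < h → ∀ d, 0 < coordX u d →
      ∀ᶠ ε in 𝓝[>] (0 : ℝ), p + ε • d ∈ openSq h z u := by
    intro u h1 h2 h3 d hd
    have hX : ∀ᶠ ε in 𝓝 (0 : ℝ), coordX u (p + ε • d - z) < h := by
      have : Continuous fun ε : ℝ => coordX u (p + ε • d - z) := by fun_prop
      exact this.continuousAt.eventually_lt continuousAt_const (by simpa using h2)
    have hY : ∀ᶠ ε in 𝓝 (0 : ℝ), |coordY u (p + ε • d - z)| < h := by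
      have : Continuous fun ε : ℝ => |coordY u (p + ε • d - z)| := by fun_prop
      exact this.continuousAt.eventually_lt continuousAt_const (by simpa using h3)
    filter_upwards [nhdsWithin_le_nhds hX, nhdsWithin_le_nhds hY, self_mem_nhdsWithin]
      with ε e1 e2 e3
    refine ⟨abs_lt.2 ⟨?_, e1⟩, e2⟩
    have : 0 < ε * coordX u d := mul_pos e3 hd
    rw [coordX_sub, coordX_add, coordX_smul]
    rw [coordX_sub] at h1
    linarith
  have aux' : ∀ u : ℝ × ℝ, |coordX u (p - z)| ≤ h → |coordY u (p - z)| < h →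
      ∃ w, SameFrame u w ∧
        ∀ d, 0 < coordX w d → ∀ᶠ ε in 𝓝[>] (0 : ℝ), p + ε • d ∈ openSq h z u := by
    intro u h1 h2
    rw [abs_le] at h1
    rcases h1.2.lt_or_eq with h3 | h3
    · exact ⟨u, .refl u, aux u h1.1 h3 h2⟩
    · have hf := (SameFrame.refl u).neg_right
      refine ⟨-u, hf, ?_⟩
      rw [← hf.openSq_eq]
      have := abs_nonneg (coordY u (p - z))
      refine aux (-u) ?_ ?_ ?_
      · rw [coordX_neg_left]; linarith
      · rw [coordX_neg_left]; linarith
      · rwa [coordY_neg_left, abs_neg]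
  rcases hp.2.lt_or_eq with h2 | h2
  · exact aux' u hp.1 h2
  · have hf : SameFrame u (quarterTurn u) := Or.inr (Or.inr (Or.inl rfl))
    have h1 := hp.1.lt_of_ne fun h1 => hv ⟨h1, h2⟩
    obtain ⟨w, hw, H⟩ := aux' (quarterTurn u) (by rw [coordX_quarterTurn]; exact h2.le)
      (by rwa [coordY_quarterTurn, abs_neg])
    exact ⟨w, hf.trans hw, by rwa [hf.openSq_eq] at H⟩

/-! ### Tilings by equal squares -/

/-- The squares with centres `z i`, inradius `h` and side directions `u i` form a locally finite
tiling of the plane. -/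
structure IsSquareTiling {ι : Type*} (h : ℝ) (z u : ι → ℝ × ℝ) : Prop where
  pos : 0 < h
  unit : ∀ i, (u i).1 ^ 2 + (u i).2 ^ 2 = 1
  covers : ∀ x, ∃ i, x ∈ closedSq h (z i) (u i)
  disjoint : ∀ i j x, x ∈ openSq h (z i) (u i) → x ∈ openSq h (z j) (u j) → i = j
  finite : ∀ R : ℝ, {i | |(z i).1| ≤ R ∧ |(z i).2| ≤ R}.Finite

namespace IsSquareTiling

variable {ι : Type*} {h : ℝ} {z u : ι → ℝ × ℝ}

theorem locallyFinite (T : IsSquareTiling h z u) :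
    LocallyFinite fun i => closedSq h (z i) (u i) := by
  intro x
  refine ⟨Metric.ball x 1, Metric.ball_mem_nhds x one_pos,
    (T.finite (|x.1| + |x.2| + 1 + 2 * h)).subset ?_⟩
  rintro i ⟨y, hy, hyx⟩
  obtain ⟨h1, h2⟩ := abs_sub_le_of_mem_closedSq (T.unit i) hy
  rw [Metric.mem_ball, Prod.dist_eq, max_lt_iff, Real.dist_eq, Real.dist_eq] at hyx
  obtain ⟨h3, h4⟩ := hyx
  have a1 := abs_nonneg x.1
  have a2 := abs_nonneg x.2
  have a3 := neg_abs_le x.1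
  have a4 := neg_abs_le x.2
  have a5 := le_abs_self x.1
  have a6 := le_abs_self x.2
  rw [abs_le] at h1 h2
  rw [abs_lt] at h3 h4
  exact ⟨abs_le.2 ⟨by linarith, by linarith⟩, abs_le.2 ⟨by linarith, by linarith⟩⟩

/-- At `p` each square contains an open half plane of directions. Two such half planes meet, forcing
`i = j`, unless their inner normals are opposite, and then the frames agree. -/
theorem sameFrame_of_mem (T : IsSquareTiling h z u) {i j : ι} {p : ℝ × ℝ}
    (hi : p ∈ closedSq h (z i) (u i)) (hj : p ∈ closedSq h (z j) (u j))
    (hvi : p ∉ vertices h (z i) (u i)) (hvj : p ∉ vertices h (z j) (u j)) :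
    SameFrame (u i) (u j) := by
  obtain ⟨w, hw, Hw⟩ := exists_halfPlane hi hvi
  obtain ⟨w', hw', Hw'⟩ := exists_halfPlane hj hvj
  have hunit : ∀ {u w : ℝ × ℝ}, SameFrame u w → u.1 ^ 2 + u.2 ^ 2 = 1 →
      w.1 ^ 2 + w.2 ^ 2 = 1 := by
    rintro u w (rfl | rfl | rfl | rfl) h
    · exact h
    all_goals
      simp only [quarterTurn, Prod.fst_neg, Prod.snd_neg, neg_sq]
      linarith
  have e := hunit hw (T.unit i)
  have e' := hunit hw' (T.unit j)
  -- This number is the inner product of `w + w'` with either normal; when positive, `w + w'` points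
  -- into both squares.
  by_cases hpos : 0 < 1 + w.1 * w'.1 + w.2 * w'.2
  · have h1 := Hw (w + w') (by simp only [coordX, Prod.fst_add, Prod.snd_add]; nlinarith)
    have h2 := Hw' (w + w') (by simp only [coordX, Prod.fst_add, Prod.snd_add]; nlinarith)
    obtain ⟨ε, hε, hε'⟩ := (h1.and h2).exists
    rw [T.disjoint i j _ hε hε']
    exact .refl _
  · have hww : w' = -w := by
      have h1 : (w.1 + w'.1) ^ 2 + (w.2 + w'.2) ^ 2 ≤ 0 := by nlinarith
      have h2 : w.1 + w'.1 = 0 := by nlinarith [sq_nonneg (w.1 + w'.1), sq_nonneg (w.2 + w'.2)]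
      have h3 : w.2 + w'.2 = 0 := by nlinarith [sq_nonneg (w.1 + w'.1), sq_nonneg (w.2 + w'.2)]
      ext
      · simp; linarith
      · simp; linarith
    rw [hww] at hw'
    exact hw.neg_right.trans hw'.symm

/-- All squares of a tiling of the plane by equal squares are parallel. -/
theorem sameFrame [Countable ι] (T : IsSquareTiling h z u) (i j : ι) : SameFrame (u i) (u j) := by
  by_contra hij
  -- By local finiteness, the tiles parallel to tile `i` and the remaining tiles have closed unions.
  -- Both meet the connected set `Vᶜ`, which they cover, so they meet each other at a non-vertex.
  set V : Set (ℝ × ℝ) := ⋃ k, vertices h (z k) (u k) with hV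
  have hVc : V.Countable := Set.countable_iUnion fun k => countable_vertices h (T.unit k)
  have hrank : 1 < Module.rank ℝ (ℝ × ℝ) := by
    rw [rank_prod', Module.rank_self]; norm_num
  have hconn := (hVc.isConnected_compl_of_one_lt_rank hrank).isPreconnected
  have hdense : Dense Vᶜ := hVc.dense_compl ℝ
  let F : {k // SameFrame (u i) (u k)} → Set (ℝ × ℝ) := fun k => closedSq h (z k) (u k)
  let F' : {k // ¬ SameFrame (u i) (u k)} → Set (ℝ × ℝ) := fun k => closedSq h (z k) (u k)
  have hF : IsClosed (⋃ k, F k) :=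
    (T.locallyFinite.comp_injective Subtype.val_injective).isClosed_iUnion
      fun _ => isClosed_closedSq _ _ _
  have hF' : IsClosed (⋃ k, F' k) :=
    (T.locallyFinite.comp_injective Subtype.val_injective).isClosed_iUnion
      fun _ => isClosed_closedSq _ _ _
  have hne : ∀ k, ∃ p ∈ Vᶜ, p ∈ closedSq h (z k) (u k) := by
    intro k
    obtain ⟨p, hp, hpV⟩ := hdense.inter_open_nonempty _ (isOpen_openSq h (z k) (u k))
      ⟨_, mem_openSq_self T.pos _ _⟩
    exact ⟨p, hpV, openSq_subset_closedSq _ _ _ hp⟩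
  obtain ⟨p, hp, hpi⟩ := hne i
  obtain ⟨q, hq, hqj⟩ := hne j
  obtain ⟨x, hxV, hx, hx'⟩ := isPreconnected_closed_iff.1 hconn _ _ hF hF' (by
    intro x _
    obtain ⟨k, hk⟩ := T.covers x
    by_cases hf : SameFrame (u i) (u k)
    · exact Or.inl (Set.mem_iUnion.2 ⟨⟨k, hf⟩, hk⟩)
    · exact Or.inr (Set.mem_iUnion.2 ⟨⟨k, hf⟩, hk⟩))
    ⟨p, hp, Set.mem_iUnion.2 ⟨⟨i, .refl _⟩, hpi⟩⟩ ⟨q, hq, Set.mem_iUnion.2 ⟨⟨j, hij⟩, hqj⟩⟩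
  obtain ⟨⟨k, hk⟩, hxk⟩ := Set.mem_iUnion.1 hx
  obtain ⟨⟨l, hl⟩, hxl⟩ := Set.mem_iUnion.1 hx'
  have hnv : ∀ k, x ∉ vertices h (z k) (u k) := fun k hkv => hxV (Set.mem_iUnion.2 ⟨k, hkv⟩)
  exact hl (hk.trans (T.sameFrame_of_mem hxk hxl (hnv k) (hnv l)))

/-- The corner of the square with centre `z` in the frame `u`, in units of the side. -/
noncomputable def corner (h : ℝ) (u z : ℝ × ℝ) : ℝ × ℝ :=
  ((coordX u z - h) / (2 * h), (coordY u z - h) / (2 * h))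

theorem abs_two_mul_sub_lt_iff (hh : 0 < h) (s c : ℝ) :
    |2 * h * s - c| < h ↔ (c - h) / (2 * h) < s ∧ s < (c - h) / (2 * h) + 1 := by
  rw [abs_lt, div_lt_iff₀ (by linarith), ← sub_lt_iff_lt_add, lt_div_iff₀ (by linarith)]
  constructor <;> rintro ⟨h1, h2⟩ <;> constructor <;> linarith

theorem abs_two_mul_sub_le_iff (hh : 0 < h) (s c : ℝ) :
    |2 * h * s - c| ≤ h ↔ (c - h) / (2 * h) ≤ s ∧ s ≤ (c - h) / (2 * h) + 1 := by
  rw [abs_le, div_le_iff₀ (by linarith), ← sub_le_iff_le_add, le_div_iff₀ (by linarith)]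
  constructor <;> rintro ⟨h1, h2⟩ <;> constructor <;> linarith

/-- Shifting a point by a small `(ε, ε)` turns half-open membership into open membership and its
failure into failure of closed membership. Local finiteness lets one `ε` serve all nearby tiles. -/
theorem isUnitSquarePartition [Countable ι] (T : IsSquareTiling h z u) (i₀ : ι) :
    IsUnitSquarePartition (Set.range fun i => corner h (u i₀) (z i)) := by
  set v := u i₀ with hv
  have hunit := T.unit i₀
  rw [← hv] at hunit
  have hpos := T.pos
  let P : ℝ → ℝ → ℝ × ℝ := fun s t =>
    (v.1 * (2 * h * s) - v.2 * (2 * h * t), v.2 * (2 * h * s) + v.1 * (2 * h * t))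
  have hPX : ∀ s t, coordX v (P s t) = 2 * h * s := by
    intro s t; simp only [coordX, P]; linear_combination (2 * h * s) * hunit
  have hPY : ∀ s t, coordY v (P s t) = 2 * h * t := by
    intro s t; simp only [coordY, P]; linear_combination (2 * h * t) * hunit
  have hopen : ∀ i s t, P s t ∈ openSq h (z i) (u i) ↔
      ((corner h v (z i)).1 < s ∧ s < (corner h v (z i)).1 + 1) ∧
        (corner h v (z i)).2 < t ∧ t < (corner h v (z i)).2 + 1 := by
    intro i s t
    rw [(T.sameFrame i₀ i).openSq_eq, ← hv, openSq, Set.mem_ofPred_eq, coordX_sub, coordY_sub, hPX,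
      hPY, abs_two_mul_sub_lt_iff hpos, abs_two_mul_sub_lt_iff hpos]
    rfl
  have hclosed : ∀ i s t, P s t ∈ closedSq h (z i) (u i) ↔
      ((corner h v (z i)).1 ≤ s ∧ s ≤ (corner h v (z i)).1 + 1) ∧
        (corner h v (z i)).2 ≤ t ∧ t ≤ (corner h v (z i)).2 + 1 := by
    intro i s t
    rw [(T.sameFrame i₀ i).closedSq_eq, ← hv, closedSq, Set.mem_ofPred_eq, coordX_sub, coordY_sub,
      hPX, hPY, abs_two_mul_sub_le_iff hpos, abs_two_mul_sub_le_iff hpos]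
    rfl
  have htend : ∀ s : ℝ, Tendsto (fun ε => s + ε) (𝓝[>] 0) (𝓝 s) := fun s =>
    (Continuous.tendsto' (by fun_prop) 0 s (by simp)).mono_left nhdsWithin_le_nhds
  have hin : ∀ c s : ℝ, c ≤ s ∧ s < c + 1 → ∀ᶠ ε in 𝓝[>] (0 : ℝ), c < s + ε ∧ s + ε < c + 1 := by
    rintro c s ⟨h1, h2⟩
    filter_upwards [(htend s).eventually_lt_const h2, self_mem_nhdsWithin] with ε e1 e2
    exact ⟨by linarith [show (0 : ℝ) < ε from e2], e1⟩
  have hout : ∀ c s : ℝ, ¬ (c ≤ s ∧ s < c + 1) →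
      ∀ᶠ ε in 𝓝[>] (0 : ℝ), ¬ (c ≤ s + ε ∧ s + ε ≤ c + 1) := by
    intro c s hcs
    rcases lt_or_ge s c with h1 | h1
    · filter_upwards [(htend s).eventually_lt_const h1] with ε e1 e2
      linarith
    · have h2 : c + 1 ≤ s := by
        by_contra h2
        exact hcs ⟨h1, not_le.1 h2⟩
      filter_upwards [self_mem_nhdsWithin] with ε e1 e2
      linarith [show (0 : ℝ) < ε from e1]
  constructor
  · intro s t
    by_contra! hcon
    have hcon' : ∀ i, ∀ᶠ ε in 𝓝[>] (0 : ℝ), P (s + ε) (t + ε) ∉ closedSq h (z i) (u i) := by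
      intro i
      by_cases hs : (corner h v (z i)).1 ≤ s ∧ s < (corner h v (z i)).1 + 1
      · have ht : ¬ ((corner h v (z i)).2 ≤ t ∧ t < (corner h v (z i)).2 + 1) := fun ht => by
          have := hcon _ ⟨i, rfl⟩ hs ht.1
          linarith [ht.2]
        filter_upwards [hout _ _ ht] with ε e1 e2
        exact e1 ((hclosed _ _ _).1 e2).2
      · filter_upwards [hout _ _ hs] with ε e1 e2
        exact e1 ((hclosed _ _ _).1 e2).1
    obtain ⟨N, hN, hfin⟩ := T.locallyFinite (P s t)
    have hPt : Tendsto (fun ε => P (s + ε) (t + ε)) (𝓝[>] (0 : ℝ)) (𝓝 (P s t)) := by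
      refine (Continuous.tendsto' ?_ 0 _ (by simp)).mono_left nhdsWithin_le_nhds
      simp only [P]
      fun_prop
    obtain ⟨ε, e1, e2⟩ := (((eventually_all_finite hfin).2 fun i _ => hcon' i).and
      (hPt hN)).exists
    obtain ⟨i, hi⟩ := T.covers (P (s + ε) (t + ε))
    exact e1 i ⟨_, hi, e2⟩ hi
  · rintro s t _ ⟨i, rfl⟩ _ ⟨j, rfl⟩ h1 h2 h3 h4
    obtain ⟨ε, ⟨⟨e1, e2⟩, e3⟩, e4⟩ :=
      (((hin _ _ h1).and (hin _ _ h2)).and (hin _ _ h3) |>.and (hin _ _ h4)).exists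
    rw [T.disjoint i j (P (s + ε) (t + ε)) ((hopen _ _ _).2 ⟨e1, e2⟩) ((hopen _ _ _).2 ⟨e3, e4⟩)]

/-- A tiling by equal squares invariant under the translations by `(2 b, 0)` and `(0, 2)` forces a
quadratic equation with integral coefficients for `b`. -/
theorem exists_int_quadratic [Countable ι] (T : IsSquareTiling h z u) {b : ℝ} (hb : 0 < b)
    (h₁ : ∀ i, ∀ k : ℤ, ∃ j, z j = z i + k • (2 * b, 0))
    (h₂ : ∀ i, ∀ k : ℤ, ∃ j, z j = z i + k • (0, 2)) :
    ∃ m n k : ℤ, (m ≠ 0 ∨ n ≠ 0) ∧ b ^ 2 * n ^ 2 + m ^ 2 = k * b := by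
  obtain ⟨i₀, -⟩ := T.covers 0
  have hP := T.isUnitSquarePartition i₀
  have hunit := T.unit i₀
  have hpos := T.pos
  set v := u i₀
  set C := Set.range fun i => corner h v (z i) with hC
  have htrans : ∀ t : ℝ × ℝ, (∀ i, ∀ k : ℤ, ∃ j, z j = z i + k • t) → ∀ c ∈ C, ∀ k : ℤ,
      c + k • (coordX v t / (2 * h), coordY v t / (2 * h)) ∈ C := by
    rintro t ht _ ⟨i, rfl⟩ k
    obtain ⟨j, hj⟩ := ht i k
    refine ⟨j, ?_⟩
    simp only [corner, hj]
    ext <;> simp [coordX, coordY] <;> ring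
  have hτ := htrans _ h₁
  have hσ := htrans _ h₂
  have hv0 : ¬ (v.1 = 0 ∧ v.2 = 0) := by
    rintro ⟨h1, h2⟩
    rw [h1, h2] at hunit
    norm_num at hunit
  rcases hP.columns_or_rows with hcol | hrow
  · obtain ⟨m, n, k, hm, hn, hk⟩ := hP.exists_int_of_columns hcol hτ hσ
    simp only [coordX, coordY] at hm hn hk
    have hm' : v.1 * b = m * h := by field_simp at hm; linarith
    have hn' : v.2 = n * h := by field_simp at hn; linarith
    refine ⟨m, n, -k, ?_, ?_⟩
    · by_contra! h0
      rw [h0.1] at hm'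
      rw [h0.2] at hn'
      simp only [Int.cast_zero, zero_mul, mul_eq_zero, hb.ne', or_false] at hm' hn'
      exact hv0 ⟨hm', hn'⟩
    · have hk' : -(n * v.2 * b) - m * v.1 = k * h := by field_simp at hk; linarith
      -- Multiplying `hk'` by `b` and substituting `v.1 b = m h`, `v.2 = n h` eliminates the
      -- direction.
      have : h * (b ^ 2 * n ^ 2 + m ^ 2) = h * ((-k : ℤ) * b) := by
        push_cast
        linear_combination (-b) * hk' - m * hm' - b ^ 2 * n * hn'
      exact mul_left_cancel₀ hpos.ne' this
  · obtain ⟨m, n, k, hm, hn, hk⟩ := hP.swap.exists_int_of_columns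
      (τ := Prod.swap (coordX v (2 * b, 0) / (2 * h), coordY v (2 * b, 0) / (2 * h)))
      (σ := Prod.swap (coordX v (0, 2) / (2 * h), coordY v (0, 2) / (2 * h)))
      (fun c hc d hd => hrow c.swap hc d.swap hd)
      (fun c hc k => hτ c.swap hc k) (fun c hc k => hσ c.swap hc k)
    simp only [coordX, coordY, Prod.swap] at hm hn hk
    have hm' : -(v.2 * b) = m * h := by field_simp at hm; linarith
    have hn' : v.1 = n * h := by field_simp at hn; linarith
    refine ⟨m, n, k, ?_, ?_⟩
    · by_contra! h0
      rw [h0.1] at hm'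
      rw [h0.2] at hn'
      simp only [Int.cast_zero, zero_mul, neg_eq_zero, mul_eq_zero, hb.ne', or_false] at hm' hn'
      exact hv0 ⟨hn', hm'⟩
    · have hk' : n * v.1 * b - m * v.2 = k * h := by field_simp at hk; linarith
      have : h * (b ^ 2 * n ^ 2 + m ^ 2) = h * (k * b) := by
        linear_combination b * hk' - m * hm' - b ^ 2 * n * hn'
      exact mul_left_cancel₀ hpos.ne' this

end IsSquareTiling

/-! ### From a covering to a tiling -/

/-- The coordinates of a point of the plane. -/
def pair (x : Plane) : ℝ × ℝ := (x 0, x 1)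

@[simp] theorem pair_add (x y : Plane) : pair (x + y) = pair x + pair y := rfl

@[simp] theorem pair_smul (t : ℝ) (x : Plane) : pair (t • x) = t • pair x := rfl

theorem pair_injective : Function.Injective pair := by
  intro x y hxy
  obtain ⟨h0, h1⟩ := Prod.ext_iff.1 hxy
  ext i
  fin_cases i
  · exact h0
  · exact h1

theorem pair_surjective : Function.Surjective pair := fun x => ⟨!₂[x.1, x.2], by simp [pair]⟩

@[fun_prop]
theorem continuous_pair : Continuous pair := by
  unfold pair; fun_prop

theorem pair_pointReflection (x y : Plane) :
    pair (Equiv.pointReflection x y) = (2 * x 0 - y 0, 2 * x 1 - y 1) := by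
  simp only [Equiv.pointReflection_apply, vsub_eq_sub, vadd_eq_add, pair, PiLp.add_apply,
    PiLp.sub_apply, Prod.mk.injEq]
  constructor <;> ring

/-- The equivalence of points in coordinates. -/
theorem equivalent_iff {b : ℝ} {x y : Plane} :
    Equivalent b x y ↔ ∃ (e : ℤˣ) (i j : ℤ),
      pair y = ((e : ℤ) : ℝ) • pair x + (2 * i * b, 2 * (j : ℝ)) := by
  constructor
  · rintro ⟨g, hg, rfl⟩
    revert x
    suffices h : ∃ (e : ℤˣ) (i j : ℤ), ∀ x : Plane,
        pair (g x) = ((e : ℤ) : ℝ) • pair x + (2 * i * b, 2 * (j : ℝ)) by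
      obtain ⟨e, i, j, h⟩ := h
      exact fun {x} => ⟨e, i, j, h x⟩
    induction hg using Submonoid.closure_induction with
    | mem g hg =>
      obtain ⟨_, ⟨i, j, rfl⟩, rfl⟩ := hg
      refine ⟨-1, i, j, fun x => ?_⟩
      rw [pair_pointReflection]
      simp only [pair, Units.val_neg, Units.val_one, Int.cast_neg, Int.cast_one, Prod.smul_mk,
        smul_eq_mul, Prod.mk_add_mk, Matrix.cons_val_zero, Matrix.cons_val_one,
        Prod.mk.injEq]
      constructor <;> ring
    | one => exact ⟨1, 0, 0, fun x => by simp⟩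
    | mul g g' _ _ ih ih' =>
      obtain ⟨e, i, j, h⟩ := ih
      obtain ⟨e', i', j', h'⟩ := ih'
      refine ⟨e * e', e * i' + i, e * j' + j, fun x => ?_⟩
      rw [Equiv.Perm.mul_apply, h, h']
      simp only [pair, Prod.smul_mk, smul_eq_mul, Prod.mk_add_mk, Units.val_mul, Prod.mk.injEq]
      push_cast
      constructor <;> ring
  · rintro ⟨e, i, j, h⟩
    have hmem : ∀ i j : ℤ, Equiv.pointReflection (!₂[(i : ℝ) * b, (j : ℝ)] : Plane) ∈
        reflectionCompositions b := fun i j =>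
      Submonoid.subset_closure ⟨_, ⟨i, j, rfl⟩, rfl⟩
    rcases Int.units_eq_one_or e with rfl | rfl
    -- A translation is the reflection in the origin followed by one in the node `(i b, j)`.
    · refine ⟨_, Submonoid.mul_mem _ (hmem i j) (hmem 0 0), pair_injective ?_⟩
      have h0 := pair_pointReflection !₂[((0 : ℤ) : ℝ) * b, ((0 : ℤ) : ℝ)] x
      obtain ⟨h1, h2⟩ := Prod.ext_iff.1 h0
      simp only [pair] at h1 h2
      rw [h, Equiv.Perm.mul_apply, pair_pointReflection, h1, h2]
      simp [pair, add_comm, mul_assoc]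
    · refine ⟨_, hmem i j, pair_injective ?_⟩
      rw [h, pair_pointReflection]
      simp only [pair, Units.val_neg, Units.val_one, Int.cast_neg, Int.cast_one, Prod.smul_mk,
        smul_eq_mul, Prod.mk_add_mk, Matrix.cons_val_zero, Matrix.cons_val_one,
        Prod.mk.injEq]
      constructor <;> ring

theorem Equivalent.symm {b : ℝ} {x y : Plane} (h : Equivalent b x y) : Equivalent b y x := by
  obtain ⟨e, i, j, h⟩ := equivalent_iff.1 h
  refine equivalent_iff.2 ⟨e, -e * i, -e * j, ?_⟩
  rw [h]
  rcases Int.units_eq_one_or e with rfl | rfl <;> ext <;> simp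

theorem IsSquareOfSide.exists_closedSq {a : ℝ} {S : Set Plane} (hS : IsSquareOfSide a S) :
    ∃ z u : ℝ × ℝ, u.1 ^ 2 + u.2 ^ 2 = 1 ∧ S = pair ⁻¹' closedSq (a / 2) z u := by
  obtain ⟨c, u, v, hu, hv, huv, rfl⟩ := hS
  have hu' : u 0 ^ 2 + u 1 ^ 2 = 1 := by
    have := EuclideanSpace.real_norm_sq_eq u
    rw [hu, Fin.sum_univ_two] at this
    linarith
  have hv' : v 0 ^ 2 + v 1 ^ 2 = 1 := by
    have := EuclideanSpace.real_norm_sq_eq v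
    rw [hv, Fin.sum_univ_two] at this
    linarith
  have huv' : u 0 * v 0 + u 1 * v 1 = 0 := by
    rw [PiLp.inner_apply, Fin.sum_univ_two] at huv
    simp only [RCLike.inner_apply, conj_trivial] at huv
    linarith
  -- The sign `σ = det(u, v)` gives `v = σ • quarterTurn u`; the symmetry of the square about its
  -- centre absorbs it.
  obtain ⟨σ, hσ⟩ : ∃ σ, σ = u 0 * v 1 - u 1 * v 0 := ⟨_, rfl⟩
  have hσ1 : σ ^ 2 = 1 := by
    have : σ ^ 2 = (u 0 ^ 2 + u 1 ^ 2) * (v 0 ^ 2 + v 1 ^ 2) - (u 0 * v 0 + u 1 * v 1) ^ 2 := by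
      rw [hσ]; ring
    rw [this, hu', hv', huv']; norm_num
  have hv0 : v 0 = -σ * u 1 := by
    rw [hσ]; linear_combination -v 0 * hu' + u 0 * huv'
  have hv1 : v 1 = σ * u 0 := by
    rw [hσ]; linear_combination -v 1 * hu' + u 1 * huv'
  have habs : ∀ t : ℝ, |σ * t| = |t| := by
    intro t
    rw [abs_mul, show |σ| = 1 by
      rcases mul_self_eq_one_iff.1 ((sq σ).symm.trans hσ1) with h | h <;> simp [h],
      one_mul]
  have hIcc : ∀ t : ℝ, t ∈ Set.Icc 0 a ↔ |t - a / 2| ≤ a / 2 := by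
    intro t
    rw [Set.mem_Icc, abs_le]
    constructor <;> rintro ⟨h1, h2⟩ <;> constructor <;> linarith
  set z : ℝ × ℝ := pair (c + (a / 2) • u + (a / 2) • v) with hz
  have hX : ∀ s t : ℝ, coordX (pair u) (pair (c + s • u + t • v) - z) = s - a / 2 := by
    intro s t
    simp only [coordX, hz, pair, PiLp.add_apply, PiLp.smul_apply, smul_eq_mul, Prod.mk_sub_mk]
    linear_combination (s - a / 2) * hu' + (t - a / 2) * huv'
  have hY : ∀ s t : ℝ, coordY (pair u) (pair (c + s • u + t • v) - z) = σ * (t - a / 2) := by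
    intro s t
    simp only [coordY, hz, pair, PiLp.add_apply, PiLp.smul_apply, smul_eq_mul, Prod.mk_sub_mk, hσ]
    ring
  refine ⟨z, pair u, hu', ?_⟩
  ext x
  constructor
  · rintro ⟨s, hs, t, ht, rfl⟩
    refine ⟨?_, ?_⟩
    · rw [hX]; exact (hIcc s).1 hs
    · rw [hY, habs]; exact (hIcc t).1 ht
  · intro hx
    obtain ⟨s, hs⟩ : ∃ s, s = coordX (pair u) (pair x - pair c) := ⟨_, rfl⟩
    obtain ⟨t, ht⟩ : ∃ t, t = σ * coordY (pair u) (pair x - pair c) := ⟨_, rfl⟩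
    have hxst : x = c + s • u + t • v := by
      refine pair_injective ?_
      simp only [coordX, coordY, pair, Prod.mk_sub_mk] at hs ht
      ext
      · simp only [pair, PiLp.add_apply, PiLp.smul_apply, smul_eq_mul]
        rw [hs, ht, hv0]
        linear_combination -(x 0 - c 0) * hu' +
          u 1 * (u 0 * (x 1 - c 1) - u 1 * (x 0 - c 0)) * hσ1
      · simp only [pair, PiLp.add_apply, PiLp.smul_apply, smul_eq_mul]
        rw [hs, ht, hv1]
        linear_combination -(x 1 - c 1) * hu' -
          u 0 * (u 0 * (x 1 - c 1) - u 1 * (x 0 - c 0)) * hσ1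
    obtain ⟨h1, h2⟩ := hx
    rw [hxst] at h1 h2 ⊢
    rw [hX] at h1
    rw [hY, habs] at h2
    exact ⟨s, (hIcc s).2 h1, t, (hIcc t).2 h2, rfl⟩

/-- Symmetries `x ↦ ± x + t` carry squares to squares. -/
theorem smul_add_mem_closedSq_iff (e : ℤˣ) (h : ℝ) (z u t x : ℝ × ℝ) :
    ((e : ℤ) : ℝ) • x + t ∈ closedSq h (((e : ℤ) : ℝ) • z + t) u ↔ x ∈ closedSq h z u := by
  rw [closedSq, closedSq, Set.mem_ofPred_eq, Set.mem_ofPred_eq, add_sub_add_right_eq_sub,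
    ← smul_sub, coordX_smul, coordY_smul]
  rcases Int.units_eq_one_or e with rfl | rfl <;> simp

theorem smul_add_mem_openSq_iff (e : ℤˣ) (h : ℝ) (z u t x : ℝ × ℝ) :
    ((e : ℤ) : ℝ) • x + t ∈ openSq h (((e : ℤ) : ℝ) • z + t) u ↔ x ∈ openSq h z u := by
  rw [openSq, openSq, Set.mem_ofPred_eq, Set.mem_ofPred_eq, add_sub_add_right_eq_sub,
    ← smul_sub, coordX_smul, coordY_smul]
  rcases Int.units_eq_one_or e with rfl | rfl <;> simp

/-- If all points of an open set are inequivalent, then it contains no centre of a central symmetry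
preserving equivalence classes. -/
theorem notMem_interior_of_pointReflection {b : ℝ} {U : Set Plane}
    (hU : ∀ x ∈ interior U, ∀ y ∈ interior U, Equivalent b x y → x = y) {i j : ℤ} {p : Plane}
    (hp : pair p = -pair p + (2 * i * b, 2 * (j : ℝ))) : p ∉ interior U := by
  intro hpU
  have hc : Tendsto (fun ε : ℝ => p + ε • !₂[(1 : ℝ), 0]) (𝓝[>] 0) (𝓝 p) :=
    (Continuous.tendsto' (by fun_prop) 0 p (by simp)).mono_left nhdsWithin_le_nhds
  have hc' : Tendsto (fun ε : ℝ => p + (-ε) • !₂[(1 : ℝ), 0]) (𝓝[>] 0) (𝓝 p) :=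
    (Continuous.tendsto' (by fun_prop) 0 p (by simp)).mono_left nhdsWithin_le_nhds
  have hn := isOpen_interior.mem_nhds hpU
  obtain ⟨ε, ⟨h1, h2⟩, h3⟩ :=
    (((hc.eventually_mem hn).and (hc'.eventually_mem hn)).and (self_mem_nhdsWithin (s := Set.Ioi (0 : ℝ)))).exists
  have heq := hU _ h1 _ h2 (equivalent_iff.2 ⟨-1, i, j, by
    rw [pair_add, pair_add, pair_smul, pair_smul]
    simp only [Units.val_neg, Units.val_one, Int.cast_neg, Int.cast_one, neg_smul, one_smul]
    rw [neg_add, add_right_comm, ← hp]⟩)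
  have h0 := congrArg (fun x : Plane => x 0) heq
  simp at h0
  have : (0 : ℝ) < ε := h3
  linarith

/-- The images of the squares of a covering under the group generated by the point reflections
tile the plane. -/
theorem IsCovering.exists_isSquareTiling {b : ℝ} (hb : 0 < b) {G : Set (Set Plane)}
    (hG : IsCovering b G) : ∃ (h : ℝ) (z u : G × ℤˣ × ℤ × ℤ → ℝ × ℝ), IsSquareTiling h z u ∧
      (∀ i, ∀ k : ℤ, ∃ j, z j = z i + k • (2 * b, 0)) ∧
      ∀ i, ∀ k : ℤ, ∃ j, z j = z i + k • (0, 2) := by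
  obtain ⟨a, ha, hsq⟩ := hG.equal_squares
  choose z u hu hS using fun S : G => (hsq S S.2).exists_closedSq
  have hfin : Finite G := hG.finite
  let t : ℤ → ℤ → ℝ × ℝ := fun i j => (2 * i * b, 2 * (j : ℝ))
  have hint : ∀ S : G, ∀ x : Plane, pair x ∈ openSq (a / 2) (z S) (u S) →
      x ∈ interior (S : Set Plane) := by
    intro S x hx
    refine interior_maximal ?_ ((isOpen_openSq (a / 2) (z S) (u S)).preimage continuous_pair) hx
    intro y hy
    rw [hS S]
    exact openSq_subset_closedSq _ _ _ hy
  have hint' : ∀ S : G, interior (S : Set Plane) ⊆ interior (⋃₀ G) := fun S =>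
    interior_mono (Set.subset_sUnion_of_mem S.2)
  have hpull : ∀ (S : G) (e : ℤˣ) (i j : ℤ) (x : ℝ × ℝ),
      x ∈ openSq (a / 2) (((e : ℤ) : ℝ) • z S + t i j) (u S) →
      ∃ y : Plane, y ∈ interior (S : Set Plane) ∧ x = ((e : ℤ) : ℝ) • pair y + t i j := by
    intro S e i j x hx
    obtain ⟨y, hy⟩ := pair_surjective (((e : ℤ) : ℝ) • (x - t i j))
    have hxy : x = ((e : ℤ) : ℝ) • pair y + t i j := by
      rw [hy, smul_smul]
      rcases Int.units_eq_one_or e with rfl | rfl <;> simp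
    rw [hxy, smul_add_mem_openSq_iff] at hx
    exact ⟨y, hint S y hx, hxy⟩
  refine ⟨a / 2, fun q => ((q.2.1 : ℤ) : ℝ) • z q.1 + t q.2.2.1 q.2.2.2, fun q => u q.1,
    ⟨by linarith, fun q => hu _, ?_, ?_, ?_⟩, ?_, ?_⟩
  · intro x
    obtain ⟨p, rfl⟩ := pair_surjective x
    obtain ⟨y, ⟨S, hSG, hyS⟩, hpy⟩ := hG.covers p
    obtain ⟨e, i, j, hp⟩ := equivalent_iff.1 hpy.symm
    refine ⟨⟨⟨S, hSG⟩, e, i, j⟩, ?_⟩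
    rw [hp]
    refine (smul_add_mem_closedSq_iff e _ _ _ (t i j) _).2 ?_
    exact (Set.ext_iff.1 (hS ⟨S, hSG⟩) y).1 hyS
  · rintro ⟨S, e, i, j⟩ ⟨S', e', i', j'⟩ x hx hx'
    obtain ⟨y, hy, hxy⟩ := hpull S e i j x hx
    obtain ⟨y', hy', hxy'⟩ := hpull S' e' i' j' x hx'
    -- Both points are equivalent to `x` and interior to the union, so the single layer condition
    -- identifies them.
    have hyy : y = y' := by
      refine hG.single_layer y (hint' S hy) y' (hint' S' hy')
        (equivalent_iff.2 ⟨e' * e, e' * (i - i'), e' * (j - j'), ?_⟩)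
      have h1 : pair y' = ((e' : ℤ) : ℝ) • (x - t i' j') := by
        rw [hxy', add_sub_cancel_right, smul_smul]
        rcases Int.units_eq_one_or e' with rfl | rfl <;> simp
      rw [h1, hxy]
      simp only [t]
      rcases Int.units_eq_one_or e' with rfl | rfl <;> ext <;> simp <;> ring
    subst hyy
    have hSS : S = S' := by
      by_contra hne
      exact Set.disjoint_left.1 (hG.disjoint_interiors S S.2 S' S'.2
        (fun h => hne (Subtype.ext h))) hy hy'
    subst hSS
    rw [hxy] at hxy'
    by_cases hee : e = e'
    · subst hee
      obtain ⟨h1, h2⟩ := Prod.ext_iff.1 (add_left_cancel hxy')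
      simp only [t] at h1 h2
      have h3 : (i : ℝ) = i' := mul_left_cancel₀ two_ne_zero (mul_right_cancel₀ hb.ne' h1)
      have h4 : (j : ℝ) = j' := mul_left_cancel₀ two_ne_zero h2
      rw [Int.cast_inj.1 h3, Int.cast_inj.1 h4]
    -- With opposite signs, `y` is fixed by a point reflection of the group, which exchanges
    -- distinct points near `y`.
    · exfalso
      have hy0 := hint' S hy
      rcases Int.units_eq_one_or e with rfl | rfl <;>
        rcases Int.units_eq_one_or e' with rfl | rfl
      · exact hee rfl
      · refine notMem_interior_of_pointReflection hG.single_layer (i := i' - i) (j := j' - j)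
          ?_ hy0
        obtain ⟨h1, h2⟩ := Prod.ext_iff.1 hxy'
        simp [t] at h1 h2
        ext
        · simp; linarith
        · simp; linarith
      · refine notMem_interior_of_pointReflection hG.single_layer (i := i - i') (j := j - j')
          ?_ hy0
        obtain ⟨h1, h2⟩ := Prod.ext_iff.1 hxy'
        simp [t] at h1 h2
        ext
        · simp; linarith
        · simp; linarith
      · exact hee rfl
  · intro R
    obtain ⟨M, hM⟩ := (Set.finite_range fun S : G => |(z S).1| + |(z S).2|).bddAbove
    set N₁ := ⌈(R + M) / (2 * b)⌉
    set N₂ := ⌈(R + M) / 2⌉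
    have hbox : (Set.univ ×ˢ Set.univ ×ˢ Set.Icc (-N₁) N₁ ×ˢ Set.Icc (-N₂) N₂ :
        Set (G × ℤˣ × ℤ × ℤ)).Finite :=
      Set.finite_univ.prod (Set.finite_univ.prod ((Set.finite_Icc _ _).prod (Set.finite_Icc _ _)))
    refine hbox.subset ?_
    rintro ⟨S, e, i, j⟩ ⟨h1, h2⟩
    have hMS : |(z S).1| + |(z S).2| ≤ M := hM ⟨S, rfl⟩
    have key : ∀ w s : ℝ, |((e : ℤ) : ℝ) * w + s| ≤ R → |w| ≤ M → |s| ≤ R + M := by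
      intro w s h3 h4
      have h5 : |((e : ℤ) : ℝ) * w| = |w| := by
        rcases Int.units_eq_one_or e with rfl | rfl <;> simp
      have h6 := abs_sub (((e : ℤ) : ℝ) * w + s) (((e : ℤ) : ℝ) * w)
      rw [add_sub_cancel_left] at h6
      linarith
    have h3 := key _ _ h1 (by linarith [abs_nonneg (z S).2])
    have h4 := key _ _ h2 (by linarith [abs_nonneg (z S).1])
    simp only [t, abs_le] at h3 h4
    have aux : ∀ (c : ℝ) (k : ℤ), 0 < c → -(R + M) ≤ k * c → k * c ≤ R + M →
        k ∈ Set.Icc (-⌈(R + M) / c⌉) ⌈(R + M) / c⌉ := by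
      intro c k hc h5 h6
      have h7 := Int.le_ceil ((R + M) / c)
      have h8 : (k : ℝ) ≤ (R + M) / c := by rwa [le_div_iff₀ hc]
      have h9 : -(k : ℝ) ≤ (R + M) / c := by rw [le_div_iff₀ hc]; linarith
      constructor
      · have : ((-k : ℤ) : ℝ) ≤ ⌈(R + M) / c⌉ := by push_cast; linarith
        have := Int.cast_le.1 this
        linarith
      · exact Int.cast_le.1 (h8.trans h7)
    exact ⟨trivial, trivial, aux _ _ (by linarith) (by linarith) (by linarith),
      aux _ _ (by norm_num) (by linarith) (by linarith)⟩
  · rintro ⟨S, e, i, j⟩ k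
    refine ⟨⟨S, e, i + k, j⟩, ?_⟩
    ext <;> simp [t]
    ring
  · rintro ⟨S, e, i, j⟩ k
    refine ⟨⟨S, e, i, j + k⟩, ?_⟩
    ext <;> simp [t]
    ring

/-! ### Rational parameters from the quadratic equation -/

theorem eq_add_sqrt_or_eq_sub_sqrt {b p r : ℝ} (h : b ^ 2 + r ^ 2 = 2 * p * b) :
    b = p + √(p ^ 2 - r ^ 2) ∨ b = p - √(p ^ 2 - r ^ 2) := by
  have h1 : p ^ 2 - r ^ 2 = (b - p) ^ 2 := by linear_combination -h
  rw [h1, Real.sqrt_sq_eq_abs]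
  rcases abs_choice (b - p) with h2 | h2 <;> rw [h2]
  · left; ring
  · right; ring

theorem exists_rat_of_quadratic {b : ℝ} (hb : 0 < b) {p r : ℚ} (hr : 0 ≤ r)
    (h : b ^ 2 + (r : ℝ) ^ 2 = 2 * p * b) :
    ∃ p r : ℚ, 0 ≤ r ∧ r ≤ p ∧
      (b = (p : ℝ) + √((p : ℝ) ^ 2 - (r : ℝ) ^ 2) ∨
        b = (p : ℝ) - √((p : ℝ) ^ 2 - (r : ℝ) ^ 2)) := by
  refine ⟨p, r, hr, ?_, eq_add_sqrt_or_eq_sub_sqrt h⟩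
  -- From `(b - r)² ≥ 0`: `2pb = b² + r² ≥ 2rb`.
  have : (r : ℝ) ≤ p := by
    by_contra! hlt
    nlinarith [sq_nonneg (b - r)]
  exact_mod_cast this

theorem IsCovering.exists_rat {b : ℝ} (hb : 0 < b) {G : Set (Set Plane)} (hG : IsCovering b G) :
    ∃ p r : ℚ, 0 ≤ r ∧ r ≤ p ∧
      (b = (p : ℝ) + √((p : ℝ) ^ 2 - (r : ℝ) ^ 2) ∨
        b = (p : ℝ) - √((p : ℝ) ^ 2 - (r : ℝ) ^ 2)) := by
  have hfin : Finite G := hG.finite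
  obtain ⟨h, z, u, T, h₁, h₂⟩ := hG.exists_isSquareTiling hb
  obtain ⟨m, n, k, hmn, H⟩ := T.exists_int_quadratic hb h₁ h₂
  by_cases hn : n = 0
  · subst hn
    have hm : m ≠ 0 := by simpa using hmn
    have hm' : (m : ℝ) ≠ 0 := by exact_mod_cast hm
    have hk : (k : ℝ) ≠ 0 := by
      rintro hk
      rw [hk] at H
      simp [hm] at H
    have hbk : b = m ^ 2 / k := by
      rw [eq_div_iff hk]
      simp at H
      linarith
    have hpos : (0 : ℚ) < m ^ 2 / k := by
      rw [hbk] at hb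
      exact_mod_cast hb
    -- Here `b` itself is rational, and `p = r = b` is a solution.
    refine exists_rat_of_quadratic (p := m ^ 2 / k) (r := m ^ 2 / k) hb hpos.le ?_
    push_cast
    rw [← hbk]
    ring
  · have hn' : (n : ℝ) ≠ 0 := by exact_mod_cast hn
    refine exists_rat_of_quadratic (p := k / (2 * n ^ 2)) (r := |(m : ℚ) / n|) hb (abs_nonneg _) ?_
    push_cast
    rw [sq_abs]
    field_simp
    linarith

/-! ### Construction of coverings -/

/-- A linear form bounded on a set is strictly within the bounds on the interior. -/
theorem coordX_mem_Ioo_of_mem_interior {w : ℝ × ℝ} (hw : w.1 ^ 2 + w.2 ^ 2 = 1) {S : Set Plane}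
    {p q : ℝ} (hS : ∀ x ∈ S, coordX w (pair x) ∈ Set.Icc p q) {x : Plane} (hx : x ∈ interior S) :
    coordX w (pair x) ∈ Set.Ioo p q := by
  have hc : ∀ s : ℝ, Tendsto (fun ε : ℝ => x + (s * ε) • !₂[w.1, w.2]) (𝓝[>] 0) (𝓝 x) := fun s =>
    (Continuous.tendsto' (by fun_prop) 0 x (by simp)).mono_left nhdsWithin_le_nhds
  have hn := mem_interior_iff_mem_nhds.1 hx
  have hval : ∀ t : ℝ, coordX w (pair (x + t • !₂[w.1, w.2])) = coordX w (pair x) + t := by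
    intro t
    rw [pair_add, pair_smul, coordX_add, coordX_smul]
    simp only [coordX, pair]
    simp only [Matrix.cons_val_zero, Matrix.cons_val_one]
    linear_combination t * hw
  obtain ⟨ε, ⟨h1, h2⟩, h3⟩ := (((hc 1).eventually_mem hn).and ((hc (-1)).eventually_mem hn)).and
    (self_mem_nhdsWithin (s := Set.Ioi (0 : ℝ))) |>.exists
  have h1 := (hS _ h1).2
  have h2 := (hS _ h2).1
  rw [hval] at h1 h2
  have h3 : 0 < ε := h3
  exact ⟨by linarith, by linarith⟩

theorem exists_nat_mem_Icc {a x : ℝ} (ha : 0 < a) (hx : 0 ≤ x) {n : ℕ} (hn : 0 < n)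
    (hxn : x ≤ n * a) : ∃ k < n, x ∈ Set.Icc ((k : ℝ) * a) ((k + 1) * a) := by
  rcases hxn.lt_or_eq with h | h
  · have h0 : 0 ≤ x / a := by positivity
    have h1 := Nat.floor_le h0
    have h2 := Nat.lt_floor_add_one (x / a)
    rw [le_div_iff₀ ha] at h1
    rw [div_lt_iff₀ ha] at h2
    exact ⟨⌊x / a⌋₊, (Nat.floor_lt h0).2 ((div_lt_iff₀ ha).2 h), h1, h2.le⟩
  -- The right endpoint `n * a` belongs to the last cell, where the floor would give one too many.
  · obtain ⟨k, rfl⟩ := Nat.exists_eq_succ_of_ne_zero hn.ne'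
    refine ⟨k, Nat.lt_succ_self k, ?_, ?_⟩
    · rw [h]; push_cast; nlinarith
    · rw [h]; push_cast; exact le_rfl

/-- The cell with indices `k`, `l` of the square grid of mesh `a` in the frame `v`. -/
def gridCell (a : ℝ) (v : ℝ × ℝ) (k l : ℕ) : Set Plane :=
  {x | coordX v (pair x) ∈ Set.Icc (k * a) ((k + 1) * a) ∧
    coordX (quarterTurn v) (pair x) ∈ Set.Icc (l * a) ((l + 1) * a)}

theorem quarterTurn_unit {v : ℝ × ℝ} (hv : v.1 ^ 2 + v.2 ^ 2 = 1) :
    (quarterTurn v).1 ^ 2 + (quarterTurn v).2 ^ 2 = 1 := by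
  simp only [quarterTurn, neg_sq]; linarith

theorem isSquareOfSide_gridCell (a : ℝ) {v : ℝ × ℝ} (hv : v.1 ^ 2 + v.2 ^ 2 = 1) (k l : ℕ) :
    IsSquareOfSide a (gridCell a v k l) := by
  have hu := quarterTurn_unit hv
  have hnorm : ∀ w : ℝ × ℝ, w.1 ^ 2 + w.2 ^ 2 = 1 → ‖(!₂[w.1, w.2] : Plane)‖ = 1 := by
    intro w hw
    rw [EuclideanSpace.norm_eq, Fin.sum_univ_two]
    simp [hw]
  set w := quarterTurn v with hw
  refine ⟨((k : ℝ) * a) • !₂[v.1, v.2] + ((l : ℝ) * a) • !₂[w.1, w.2], !₂[v.1, v.2],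
    !₂[w.1, w.2], hnorm v hv, hnorm w hu, ?_, ?_⟩
  · rw [PiLp.inner_apply, Fin.sum_univ_two]
    simp [hw, quarterTurn]
    ring
  · have hpair : ∀ s t : ℝ, pair (((k : ℝ) * a) • !₂[v.1, v.2] + ((l : ℝ) * a) • !₂[w.1, w.2] +
        s • !₂[v.1, v.2] + t • !₂[w.1, w.2]) = (k * a + s) • v + (l * a + t) • w := by
      intro s t
      ext <;> simp [pair] <;> ring
    have hvv : coordX v v = 1 := by simp only [coordX]; linarith
    have hww : coordX w w = 1 := by simp only [coordX]; linarith
    have hvw : coordX v w = 0 := by simp only [coordX, hw, quarterTurn]; ring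
    have hwv : coordX w v = 0 := by simp only [coordX, hw, quarterTurn]; ring
    ext x
    constructor
    · rintro ⟨⟨h1, h2⟩, h3, h4⟩
      refine ⟨coordX v (pair x) - k * a, ⟨by linarith, by linarith⟩,
        coordX w (pair x) - l * a, ⟨by linarith, by linarith⟩, pair_injective ?_⟩
      rw [hpair]
      have := sq_add_sq_coord hv (pair x)
      rw [← coordX_quarterTurn, ← hw] at this
      ext
      · rw [this.1]; simp [hw, quarterTurn]; ring
      · rw [this.2]; simp [hw, quarterTurn]; ring
    · rintro ⟨s, ⟨h1, h2⟩, t, ⟨h3, h4⟩, rfl⟩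
      simp only [gridCell, Set.mem_ofPred_eq, hpair, coordX_add, coordX_smul, ← hw, hvv, hww, hvw,
        hwv]
      exact ⟨⟨by linarith, by linarith⟩, by linarith, by linarith⟩

theorem disjoint_interior_gridCell {a : ℝ} (ha : 0 < a) {v : ℝ × ℝ} (hv : v.1 ^ 2 + v.2 ^ 2 = 1)
    {k l k' l' : ℕ} (hne : gridCell a v k l ≠ gridCell a v k' l') :
    Disjoint (interior (gridCell a v k l)) (interior (gridCell a v k' l')) := by
  rw [Set.disjoint_left]
  intro x hx hx'
  have aux : ∀ {y : ℝ} {k k' : ℕ}, y ∈ Set.Ioo (k * a) ((k + 1) * a) →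
      y ∈ Set.Ioo (k' * a) ((k' + 1) * a) → k = k' := by
    rintro y k k' ⟨h1, h2⟩ ⟨h3, h4⟩
    have h5 : (k : ℝ) < k' + 1 := lt_of_mul_lt_mul_right (h1.trans h4) ha.le
    have h6 : (k' : ℝ) < k + 1 := lt_of_mul_lt_mul_right (h3.trans h2) ha.le
    have h5 : k < k' + 1 := by exact_mod_cast h5
    have h6 : k' < k + 1 := by exact_mod_cast h6
    omega
  have hk : k = k' := aux (coordX_mem_Ioo_of_mem_interior hv (fun _ h => h.1) hx)
    (coordX_mem_Ioo_of_mem_interior hv (fun _ h => h.1) hx')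
  have hl : l = l' := aux (coordX_mem_Ioo_of_mem_interior (quarterTurn_unit hv) (fun _ h => h.2) hx)
    (coordX_mem_Ioo_of_mem_interior (quarterTurn_unit hv) (fun _ h => h.2) hx')
  exact hne (by rw [hk, hl])

/-- Suppose that, in the frame `v`, the nodes of the lattice have first coordinates `A (i m + j n)`
with `m` and `n` coprime, and that the primitive node on the second axis is at distance `B / 2`.
If the sides `A` and `B` of a rectangle are multiples of `a`, then there is a covering by squares
of side `a`. -/
theorem exists_isCovering_of_frame {b A B a : ℝ} (hA : 0 < A) (hB : 0 < B)
    (ha : 0 < a) {v : ℝ × ℝ} (hv : v.1 ^ 2 + v.2 ^ 2 = 1) {m n : ℤ} (hn : n ≠ 0)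
    (hmn : IsCoprime m n) (hvm : v.1 * b = A * m) (hvn : v.2 = A * n)
    (hvB : 2 * (v.2 * (n * b) + v.1 * m) = B) {M N : ℕ} (hM : M * a = A) (hN : N * a = B) :
    ∃ G, IsCovering b G := by
  have hM0 : 0 < M := Nat.pos_of_ne_zero (by rintro rfl; simp at hM; linarith)
  have hN0 : 0 < N := Nat.pos_of_ne_zero (by rintro rfl; simp at hN; linarith)
  have hu := quarterTurn_unit hv
  have hX : ∀ i j : ℤ, coordX v (2 * i * b, 2 * (j : ℝ)) = 2 * A * (i * m + j * n) := by
    intro i j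
    simp only [coordX]
    linear_combination 2 * i * hvm + 2 * j * hvn
  have hX' : ∀ k : ℤ, coordX v (2 * ((-(k * n) : ℤ) : ℝ) * b, 2 * ((k * m : ℤ) : ℝ)) = 0 := by
    intro k
    rw [hX]; push_cast; ring
  have hY : ∀ k : ℤ, coordX (quarterTurn v)
      (2 * ((-(k * n) : ℤ) : ℝ) * b, 2 * ((k * m : ℤ) : ℝ)) = k * B := by
    intro k
    simp only [coordX, quarterTurn]
    push_cast
    linear_combination k * hvB
  set G : Set (Set Plane) :=
    (fun q : ℕ × ℕ => gridCell a v q.1 q.2) '' (Set.Iio M ×ˢ Set.Iio N) with hG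
  have hsub : ∀ x ∈ ⋃₀ G, coordX v (pair x) ∈ Set.Icc 0 A ∧
      coordX (quarterTurn v) (pair x) ∈ Set.Icc 0 B := by
    rintro x ⟨_, ⟨⟨k, l⟩, ⟨hk, hl⟩, rfl⟩, ⟨h1, h2⟩, h3, h4⟩
    have hk' : ((k : ℝ) + 1) ≤ M := by exact_mod_cast hk
    have hl' : ((l : ℝ) + 1) ≤ N := by exact_mod_cast hl
    simp only at h1 h2 h3 h4
    exact ⟨⟨(by positivity : (0 : ℝ) ≤ k * a).trans h1,
      by rw [← hM]; exact h2.trans (mul_le_mul_of_nonneg_right hk' ha.le)⟩,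
      (by positivity : (0 : ℝ) ≤ l * a).trans h3,
      by rw [← hN]; exact h4.trans (mul_le_mul_of_nonneg_right hl' ha.le)⟩
  have hsup : ∀ x : Plane, coordX v (pair x) ∈ Set.Icc 0 A →
      coordX (quarterTurn v) (pair x) ∈ Set.Icc 0 B → x ∈ ⋃₀ G := by
    rintro x ⟨h1, h2⟩ ⟨h3, h4⟩
    obtain ⟨k, hk, hk'⟩ := exists_nat_mem_Icc ha h1 hM0 (h2.trans_eq hM.symm)
    obtain ⟨l, hl, hl'⟩ := exists_nat_mem_Icc ha h3 hN0 (h4.trans_eq hN.symm)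
    exact ⟨_, ⟨(k, l), ⟨hk, hl⟩, rfl⟩, hk', hl'⟩
  refine ⟨G, ((Set.finite_Iio M).prod (Set.finite_Iio N)).image _, ⟨a, ha, ?_⟩, ?_, ?_, ?_⟩
  · rintro _ ⟨q, -, rfl⟩
    exact isSquareOfSide_gridCell a hv _ _
  · rintro _ ⟨q, -, rfl⟩ _ ⟨q', -, rfl⟩ hne
    exact disjoint_interior_gridCell ha hv hne
  · intro x
    obtain ⟨i₀, j₀, hij⟩ := hmn
    have hij' : (i₀ : ℝ) * m + j₀ * n = 1 := by exact_mod_cast hij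
    -- Subtracting the nearest multiple of `2A` leaves a first coordinate in `[-A, A]`, and the sign
    -- `e` folds it into `[0, A]`. The Bézout coefficients realise this shift in `2Λ`; a multiple of
    -- the period `B` then corrects the second coordinate alone.
    set q := round (coordX v (pair x) / (2 * A)) with hq
    have hround := abs_sub_round (coordX v (pair x) / (2 * A))
    rw [← hq] at hround
    obtain ⟨e, he⟩ : ∃ e : ℤˣ, ((e : ℤ) : ℝ) * (coordX v (pair x) - 2 * A * q) ∈ Set.Icc 0 A := by
      have h1 : |coordX v (pair x) - 2 * A * q| ≤ A := by
        have : coordX v (pair x) - 2 * A * q = 2 * A * (coordX v (pair x) / (2 * A) - q) := by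
          field_simp
        rw [this, abs_mul, abs_of_pos (by linarith : 0 < 2 * A)]
        nlinarith
      rcases abs_choice (coordX v (pair x) - 2 * A * q) with h2 | h2
      · refine ⟨1, ?_, ?_⟩
        · simpa using abs_eq_self.1 h2
        · rw [h2] at h1; simpa using h1
      · refine ⟨-1, ?_, ?_⟩
        · simpa using abs_eq_neg_self.1 h2
        · rw [h2] at h1; simpa using h1
    set r := coordX (quarterTurn v) (((e : ℤ) : ℝ) • pair x +
      (2 * ((-(e * q * i₀) : ℤ) : ℝ) * b, 2 * ((-(e * q * j₀) : ℤ) : ℝ))) with hr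
    set f := ⌊r / B⌋ with hf
    have hf1 := Int.floor_le (r / B)
    have hf2 := Int.lt_floor_add_one (r / B)
    rw [← hf, le_div_iff₀ hB] at hf1
    rw [← hf, div_lt_iff₀ hB] at hf2
    obtain ⟨y, hy⟩ := pair_surjective (((e : ℤ) : ℝ) • pair x +
      (2 * ((-(e * q * i₀) : ℤ) : ℝ) * b, 2 * ((-(e * q * j₀) : ℤ) : ℝ)) +
      (2 * ((-(-f * n) : ℤ) : ℝ) * b, 2 * ((-f * m : ℤ) : ℝ)))
    refine ⟨y, hsup y ?_ ?_, equivalent_iff.2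
      ⟨e, -(e * q * i₀) + -(-f * n), -(e * q * j₀) + -f * m, ?_⟩⟩
    · rw [hy, coordX_add, hX', coordX_add, hX, coordX_smul]
      convert he using 1
      push_cast
      linear_combination (-(2 * A * e * q)) * hij'
    · rw [hy, coordX_add, hY, ← hr]
      push_cast
      exact ⟨by linarith, by linarith⟩
    · rw [hy, add_assoc]
      congr 1
      ext
      · simp only [Prod.fst_add]; push_cast; ring
      · simp only [Prod.snd_add]; push_cast; ring
  · intro x hx y hy hxy
    have hx1 := coordX_mem_Ioo_of_mem_interior hv (fun z hz => (hsub z hz).1) hx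
    have hx2 := coordX_mem_Ioo_of_mem_interior hu (fun z hz => (hsub z hz).2) hx
    have hy1 := coordX_mem_Ioo_of_mem_interior hv (fun z hz => (hsub z hz).1) hy
    have hy2 := coordX_mem_Ioo_of_mem_interior hu (fun z hz => (hsub z hz).2) hy
    obtain ⟨e, i, j, H⟩ := equivalent_iff.1 hxy
    have hbound : ∀ {C : ℝ} {k : ℤ} {s : ℝ}, 0 < C → -C < s → s < C → s = C * k → k = 0 := by
      intro C k s hC h1 h2 h3
      rw [h3] at h1 h2
      have h4 : (-1 : ℝ) < k := by nlinarith
      have h5 : (k : ℝ) < 1 := by nlinarith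
      have h4 : -1 < k := by exact_mod_cast h4
      have h5 : k < 1 := by exact_mod_cast h5
      omega
    have HX : coordX v (pair y) = ((e : ℤ) : ℝ) * coordX v (pair x) + 2 * A * (i * m + j * n) := by
      rw [H, coordX_add, coordX_smul, hX]
    obtain ⟨hx1, hx1'⟩ := hx1
    obtain ⟨hy1, hy1'⟩ := hy1
    rcases Int.units_eq_one_or e with rfl | rfl
    · simp only [Units.val_one, Int.cast_one, one_mul] at HX
      have h0 : i * m + j * n = 0 := hbound (C := 2 * A)
        (s := coordX v (pair y) - coordX v (pair x)) (by linarith) (by linarith) (by linarith)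
        (by push_cast; linarith)
      -- By coprimality, a translation with zero first coordinate is a multiple of `(n, -m)`, so it
      -- shifts the second coordinate by a multiple of `B`.
      obtain ⟨k, hk⟩ : n ∣ i := hmn.symm.dvd_of_dvd_mul_right ⟨-j, by linarith⟩
      have hj : j = -k * m := by
        refine mul_right_cancel₀ hn ?_
        rw [hk] at h0
        linarith
      have hi : i = -(-k * n) := by rw [hk]; ring
      rw [hi, hj] at H
      have HY := hY (-k)
      have hk0 : -k = 0 := hbound (C := B)
        (s := coordX (quarterTurn v) (pair y) - coordX (quarterTurn v) (pair x)) hB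
        (by linarith [hx2.2, hy2.1]) (by linarith [hx2.1, hy2.2])
        (by rw [H, coordX_add, coordX_smul, HY]; simp; ring)
      rw [hk0] at H
      refine pair_injective (H.trans ?_).symm
      ext <;> simp
    · exfalso
      simp only [Units.val_neg, Units.val_one, Int.cast_neg, Int.cast_one, neg_mul, one_mul] at HX
      -- The two first coordinates sum to a multiple of `2A` lying strictly between `0` and `2A`.
      have h1 : (0 : ℝ) < (i * m + j * n : ℤ) := by push_cast; nlinarith
      have h2 : ((i * m + j * n : ℤ) : ℝ) < 1 := by push_cast; nlinarith
      have h1 : 0 < i * m + j * n := by exact_mod_cast h1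
      have h2 : i * m + j * n < 1 := by exact_mod_cast h2
      omega

/-- With `r = m/n` and `K = 2n²p`, the equation reads `K b = n²b² + m²`. Making `v = A (m/b, n)` a
unit vector forces `A² = b/K`, and then `B = 2 K A`. Since `K` is rational, `A / K.den` divides both
sides of the rectangle. -/
theorem exists_isCovering_of_quadratic {b : ℝ} (hb : 0 < b) {p r : ℚ}
    (h : b ^ 2 + (r : ℝ) ^ 2 = 2 * p * b) : ∃ G, IsCovering b G := by
  have hn0 : (0 : ℝ) < r.den := by exact_mod_cast r.den_pos
  have hr : (r : ℝ) * r.den = r.num := by exact_mod_cast r.mul_den_eq_num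
  have hp : 0 < (p : ℝ) := by
    by_contra! hp
    nlinarith [sq_nonneg (r : ℝ), mul_pos hb hb]
  obtain ⟨K, hK⟩ : ∃ K : ℚ, K = 2 * r.den ^ 2 * p := ⟨_, rfl⟩
  have hp' : 0 < p := by exact_mod_cast hp
  have hK0 : 0 < K := by rw [hK]; have := r.den_pos; positivity
  have hK0' : (0 : ℝ) < K := by exact_mod_cast hK0
  have hKR : (K : ℝ) * b = r.den ^ 2 * b ^ 2 + r.num ^ 2 := by
    rw [hK, ← hr]
    push_cast
    linear_combination (-(r.den : ℝ) ^ 2) * h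
  set A := √(b / K) with hA
  have hA0 : 0 < A := Real.sqrt_pos.2 (by positivity)
  have hA2 : A ^ 2 * K = b := by
    rw [hA, Real.sq_sqrt (by positivity)]
    field_simp
  have hd0 : (0 : ℝ) < K.den := by exact_mod_cast K.den_pos
  have hKd : (K : ℝ) * K.den = K.num := by exact_mod_cast K.mul_den_eq_num
  have hnum : ((K.num.toNat : ℕ) : ℝ) = K.num := by
    exact_mod_cast Int.toNat_of_nonneg (Rat.num_pos.2 hK0).le
  have key : A ^ 2 * (r.den ^ 2 * b ^ 2 + r.num ^ 2) = b ^ 2 := by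
    rw [← hKR]
    linear_combination b * hA2
  refine exists_isCovering_of_frame (b := b) (A := A) (B := 2 * K * A) (a := A / K.den)
    (v := (A * r.num / b, A * r.den)) (m := r.num) (n := r.den) (M := K.den)
    (N := 2 * K.num.toNat) hA0 (by positivity) (by positivity) ?_ (by exact_mod_cast r.den_nz)
    (Int.isCoprime_iff_gcd_eq_one.2 r.reduced) ?_ (by simp) ?_ ?_ ?_
  · simp only
    field_simp
    linear_combination key
  · field_simp
  · simp only [Int.cast_natCast]
    field_simp
    linear_combination -hKR
  · field_simp
  · push_cast
    rw [hnum, ← hKd]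
    field_simp

end EnvelopeCovering

theorem mainTheorem1 (b : ℝ) (hb : 0 < b) :
    (∃ G : Set (Set EnvelopeCovering.Plane), EnvelopeCovering.IsCovering b G) ↔
      ∃ p r : ℚ, 0 ≤ r ∧ r ≤ p ∧
        (b = (p : ℝ) + √((p : ℝ) ^ 2 - (r : ℝ) ^ 2) ∨
          b = (p : ℝ) - √((p : ℝ) ^ 2 - (r : ℝ) ^ 2)) := by
  refine ⟨fun ⟨G, hG⟩ => hG.exists_rat hb, ?_⟩
  rintro ⟨p, r, hr, hrp, h⟩
  have hr' : (0 : ℝ) ≤ r := by exact_mod_cast hr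
  have hrp' : (r : ℝ) ≤ p := by exact_mod_cast hrp
  have hsq := Real.sq_sqrt (show (0 : ℝ) ≤ (p : ℝ) ^ 2 - (r : ℝ) ^ 2 by nlinarith)
  refine EnvelopeCovering.exists_isCovering_of_quadratic hb (p := p) (r := r) ?_
  rcases h with h | h
  · rw [h]; linear_combination hsq
  · rw [h]; linear_combination hsq
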